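/- Let $(\mathbb S,\le)$ be a linearly ordered set. A convolution system $\mathscr S$ over $\mathbb S$ consists of probability spaces $(\Omega_{s,t},\mathcal F_{s,t},\mu_{s,t})$ for $s<t$ and measurable, measure-preserving maps $T_{r,s,t}:\Omega_{r,s}\times\Omega_{s,t}\to\Omega_{r,t}$ for $r<s<t$ (the domain carrying the product $\sigma$-field and measure) that are associative: $T_{r,t,u}\circ(T_{r,s,t}\times\mathrm{id})=T_{r,s,u}\circ(\mathrm{id}\times T_{s,t,u})$ for $r<s<t<u$, where it suffices that this holds almost everywhere. It is a continuous product of probability spaces (CPPS) if all $T_{r,s,t}$ are isomorphisms of probability spaces, i.e. measure-preserving bijections that are measurable in both directions. For $s<t$ let $\mathcal K_{s,t}$ be the set of all finite $I\subseteq[s,t]$ with $s,t\in I$, ordered by inclusion. For $I=\{s=\iota_0<\dots<\iota_{m+1}=t\}$ let $(\Omega_I,\mathcal F_I,\mu_I)$ be the product of the probability spaces $(\Omega_{\iota_k,\iota_{k+1}},\mathcal F_{\iota_k,\iota_{k+1}},\mu_{\iota_k,\iota_{k+1}})$, $0\le k\le m$. For $I\subseteq J$ in $\mathcal K_{s,t}$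 let $T_{I,J}:\Omega_J\to\Omega_I$ be the map whose component in $\Omega_{\iota_k,\iota_{k+1}}$ is the iterated product (by the maps $T$, from left to right) of the components over the part of $J$ in $[\iota_k,\iota_{k+1}]$. Let $\Omega^\flat_{s,t}$ be the set of threads, i.e. of all $(\omega_I)_{I}\in\prod_{I\in\mathcal K_{s,t}}\Omega_I$ with $\omega_I=T_{I,J}(\omega_J)$ whenever $I\subseteq J$, let $T^\flat_I:\Omega^\flat_{s,t}\to\Omega_I$ be the coordinate projections, and let $\mathcal F^\flat_{s,t}$ be the $\sigma$-field generated by the field $\bigcup_I (T^\flat_I)^{-1}(\mathcal F_I)$. The system $\mathscr S$ is called convergent if, for all $s<t$, the set $\Omega^\flat_{s,t}$ is non-empty, all $T^\flat_I$ are surjective, and the set function $(T^\flat_I)^{-1}(A)\mapsto\mu_I(A)$ ($I\in\mathcal K_{s,t}$, $A\in\mathcal F_I$) is $\sigma$-additive on that field; $\mu^\flat_{s,t}$ then denotes its unique extension to a probability measure on $\mathcal F^\flat_{s,t}$. **Theorem.** Let $\mathscr S$ be a convergent convolution system over $\mathbb S$. Then there are isomorphisms of probability spaces $$T^\flat_{r,s,t}:(\Omega^\flat_{r,s},\mathcal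 F^\flat_{r,s},\mu^\flat_{r,s})\times(\Omega^\flat_{s,t},\mathcal F^\flat_{s,t},\mu^\flat_{s,t})\to(\Omega^\flat_{r,t},\mathcal F^\flat_{r,t},\mu^\flat_{r,t}),\qquad r<s<t \text{ in } \mathbb S,$$ that are compatible with the canonical projections, i.e. $T^\flat_{I\cup J}\circ T^\flat_{r,s,t}=T^\flat_I\times T^\flat_J$ for all $I\in\mathcal K_{r,s}$ and $J\in\mathcal K_{s,t}$ (with $\Omega_{I\cup J}$ identified with $\Omega_I\times\Omega_J$), and that are associative everywhere. Hence $\mathscr S^\flat=\{\Omega^\flat_{s,t},\mathcal F^\flat_{s,t},\mu^\flat_{s,t},T^\flat_{r,s,t}\}_{\mathbb S}$ is a CPPS. -/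

import Mathlib

open Set MeasureTheory
open scoped ENNReal

/-! ### Projective systems of probability spaces and their limits -/

namespace ProjSys

variable {ι : Type*} [Preorder ι] {X : ι → Type*}

/-- The projective limit in the category of sets of the spaces `X i` with connecting maps
`f : X j → X i` for `i ≤ j`: the set of all threads. -/
def Threads (f : ∀ ⦃i j : ι⦄, i ≤ j → X j → X i) : Type _ :=
  {ω : ∀ i, X i // ∀ ⦃i j : ι⦄ (h : i ≤ j), ω i = f h (ω j)}

variable {f : ∀ ⦃i j : ι⦄, i ≤ j → X j → X i}

/-- The coordinate projections of the projective limit. -/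
def Threads.proj (i : ι) (ω : Threads f) : X i := ω.1 i

/-- The σ-field on the projective limit: the join of the pulled back σ-fields. -/
instance Threads.instMeasurableSpace [m : ∀ i, MeasurableSpace (X i)] :
    MeasurableSpace (Threads f) :=
  ⨆ i, (m i).comap (Threads.proj i)

variable (f) in
/-- Simple maximality: there are threads, and all coordinate projections are onto. -/
def SimplyMaximal : Prop :=
  Nonempty (Threads f) ∧ ∀ i, Function.Surjective (Threads.proj (f := f) i)

variable (f) in
/-- The set function `proj i ⁻¹' A ↦ μ i A` on the field of all sets `proj i ⁻¹' A`, with `i`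
arbitrary and `A` measurable, is σ-additive on this field. -/
def SigmaAdditive [∀ i, MeasurableSpace (X i)] (μ : ∀ i, Measure (X i)) : Prop :=
  ∀ (i : ι) (A : Set (X i)) (j : ℕ → ι) (B : ∀ n, Set (X (j n))),
    MeasurableSet A → (∀ n, MeasurableSet (B n)) →
    (∀ m n, m ≠ n →
      Disjoint (Threads.proj (f := f) (j m) ⁻¹' B m) (Threads.proj (f := f) (j n) ⁻¹' B n)) →
    Threads.proj (f := f) i ⁻¹' A = ⋃ n, Threads.proj (f := f) (j n) ⁻¹' B n →
    μ i A = ∑' n, μ (j n) (B n)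

variable (f) in
/-- Convergence of a projective system of probability spaces. -/
def Convergent [∀ i, MeasurableSpace (X i)] (μ : ∀ i, Measure (X i)) : Prop :=
  SimplyMaximal f ∧ SigmaAdditive f μ

lemma Threads.measurable_proj [∀ i, MeasurableSpace (X i)] (i : ι) :
    Measurable (Threads.proj (f := f) i) :=
  Measurable.of_comap_le (le_iSup (fun i => MeasurableSpace.comap (Threads.proj (f := f) i) _) i)

lemma Threads.proj_eq {i j : ι} (h : i ≤ j) (ω : Threads f) : ω.proj i = f h (ω.proj j) := ω.2 h

variable (f) in
/-- The field of cylinder sets. -/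
def cylinders [∀ i, MeasurableSpace (X i)] : Set (Set (Threads f)) :=
  {s | ∃ (i : ι) (A : Set (X i)), MeasurableSet A ∧ s = Threads.proj i ⁻¹' A}

lemma common_index [∀ i, MeasurableSpace (X i)] [IsDirectedOrder ι]
    (hf : ∀ ⦃i j : ι⦄ (h : i ≤ j), Measurable (f h)) {s t : Set (Threads f)}
    (hs : s ∈ cylinders f) (ht : t ∈ cylinders f) :
    ∃ (k : ι) (A B : Set (X k)), MeasurableSet A ∧ MeasurableSet B ∧
      s = Threads.proj k ⁻¹' A ∧ t = Threads.proj k ⁻¹' B := by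
  obtain ⟨i, A, hA, rfl⟩ := hs
  obtain ⟨j, B, hB, rfl⟩ := ht
  obtain ⟨k, hi, hj⟩ := exists_ge_ge i j
  refine ⟨k, f hi ⁻¹' A, f hj ⁻¹' B, hf hi hA, hf hj hB, ?_, ?_⟩ <;> ext ω <;>
    simp [← Threads.proj_eq]

lemma isSetRing_cylinders [∀ i, MeasurableSpace (X i)] [IsDirectedOrder ι] [Nonempty ι]
    (hf : ∀ ⦃i j : ι⦄ (h : i ≤ j), Measurable (f h)) : IsSetRing (cylinders f) where
  empty_mem := ⟨Classical.arbitrary ι, ∅, MeasurableSet.empty, by simp⟩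
  union_mem s t hs ht := by
    obtain ⟨k, A, B, hA, hB, rfl, rfl⟩ := common_index hf hs ht
    exact ⟨k, A ∪ B, hA.union hB, by simp⟩
  sdiff_mem s t hs ht := by
    obtain ⟨k, A, B, hA, hB, rfl, rfl⟩ := common_index hf hs ht
    exact ⟨k, A \ B, hA.diff hB, by simp⟩

lemma generateFrom_cylinders [∀ i, MeasurableSpace (X i)] :
    (Threads.instMeasurableSpace : MeasurableSpace (Threads f)) =
      MeasurableSpace.generateFrom (cylinders f) := by
  apply le_antisymm
  · refine iSup_le fun i => ?_
    rintro s ⟨A, hA, rfl⟩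
    exact MeasurableSpace.measurableSet_generateFrom ⟨i, A, hA, rfl⟩
  · refine MeasurableSpace.generateFrom_le ?_
    rintro s ⟨i, A, hA, rfl⟩
    exact Threads.measurable_proj i hA

/-- The set function of a convergent system extends uniquely from the field of cylinder sets to a
measure on the generated σ-field. -/
theorem existsUnique_limit [∀ i, MeasurableSpace (X i)] {μ : ∀ i, Measure (X i)}
    [∀ i, IsProbabilityMeasure (μ i)] [IsDirectedOrder ι] [Nonempty ι]
    (hf : ∀ ⦃i j : ι⦄ (h : i ≤ j), Measurable (f h)) (hc : Convergent f μ) :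
    ∃! ν : Measure (Threads f),
      ∀ (i : ι) (A : Set (X i)), MeasurableSet A → ν (Threads.proj i ⁻¹' A) = μ i A := by
  classical
  have hR := isSetRing_cylinders (f := f) hf
  have wd : ∀ (i j : ι) (A : Set (X i)) (B : Set (X j)), MeasurableSet A → MeasurableSet B →
      Threads.proj (f := f) i ⁻¹' A = Threads.proj j ⁻¹' B → μ i A = μ j B := by
    intro i j A B hA hB h
    have := hc.2 i A (fun _ => j) (fun n => if n = 0 then B else ∅) hA
      (fun n => by split_ifs <;> simp [hB])
      (fun m n hmn => by
        by_cases hm : m = 0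
        · have hn : n ≠ 0 := fun hn => hmn (hm.trans hn.symm)
          simp [hn]
        · simp [hm])
      (by
        rw [h]
        ext ω
        simp only [mem_preimage, mem_iUnion]
        constructor
        · intro hω
          exact ⟨0, by simpa using hω⟩
        · rintro ⟨n, hn⟩
          by_cases h0 : n = 0
          · simpa [h0] using hn
          · simp [h0] at hn)
    rw [this, tsum_eq_single 0]
    · simp
    · intro n hn
      simp [hn]
  let m0 : Set (Threads f) → ℝ≥0∞ := fun s =>
    if h : s ∈ cylinders f then μ h.choose h.choose_spec.choose else 0
  have m0_eq : ∀ (i : ι) (A : Set (X i)), MeasurableSet A →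
      m0 (Threads.proj i ⁻¹' A) = μ i A := by
    intro i A hA
    have h : Threads.proj (f := f) i ⁻¹' A ∈ cylinders f := ⟨i, A, hA, rfl⟩
    simp only [m0, dif_pos h]
    exact wd _ _ _ _ h.choose_spec.choose_spec.1 hA h.choose_spec.choose_spec.2.symm
  have m0_empty : m0 ∅ = 0 := by
    have := m0_eq (Classical.arbitrary ι) ∅ MeasurableSet.empty
    simpa using this
  let m : AddContent ℝ≥0∞ (cylinders f) := hR.addContent_of_union m0 m0_empty (by
    intro s t hs ht hd
    obtain ⟨k, A, B, hA, hB, rfl, rfl⟩ := common_index hf hs ht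
    have hAB : Disjoint A B := by
      rw [Set.disjoint_left]
      intro x hxA hxB
      obtain ⟨ω, rfl⟩ := hc.1.2 k x
      exact Set.disjoint_left.1 hd hxA hxB
    rw [← preimage_union, m0_eq k _ (hA.union hB), m0_eq k A hA, m0_eq k B hB,
      measure_union hAB hB])
  have m_eq : ∀ (i : ι) (A : Set (X i)), MeasurableSet A →
      m (Threads.proj i ⁻¹' A) = μ i A := m0_eq
  have hsub : m.IsSigmaSubadditive := by
    refine isSigmaSubadditive_of_addContent_iUnion_eq_tsum hR ?_
    intro g hg hU hd
    choose j B hB hgB using hg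
    obtain ⟨i, A, hA, hUA⟩ := hU
    rw [hUA, m_eq i A hA, hc.2 i A j B hA hB ?_ ?_]
    · refine tsum_congr fun n => ?_
      rw [hgB n, m_eq _ _ (hB n)]
    · intro a b hab
      rw [← hgB, ← hgB]
      exact hd hab
    · rw [← hUA]
      exact iUnion_congr hgB
  refine ⟨m.measure hR.isSetSemiring generateFrom_cylinders.le hsub, ?_, ?_⟩
  · intro i A hA
    rw [m.measure_eq hR.isSetSemiring generateFrom_cylinders hsub ⟨i, A, hA, rfl⟩, m_eq i A hA]
  · intro ν hν
    have key : ∀ i (A : Set (X i)), MeasurableSet A →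
        m.measure hR.isSetSemiring generateFrom_cylinders.le hsub (Threads.proj i ⁻¹' A) = μ i A := by
      intro i A hA
      rw [m.measure_eq hR.isSetSemiring generateFrom_cylinders hsub ⟨i, A, hA, rfl⟩, m_eq i A hA]
    have hfin : ν univ = 1 := by
      have := hν (Classical.arbitrary ι) univ MeasurableSet.univ
      simpa using this
    have : IsFiniteMeasure ν := ⟨by rw [hfin]; exact ENNReal.one_lt_top⟩
    refine ext_of_generate_finite _ generateFrom_cylinders hR.isSetSemiring.isPiSystem ?_ ?_
    · rintro s ⟨i, A, hA, rfl⟩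
      rw [hν i A hA, key i A hA]
    · have := key (Classical.arbitrary ι) univ MeasurableSet.univ
      rw [hfin]
      simpa using this.symm

/-- The measure of the projective limit of a convergent system of probability spaces: the unique
measure `ν` with `ν (proj i ⁻¹' A) = μ i A` for all `i` and all measurable `A`. -/
noncomputable def limitMeasure [∀ i, MeasurableSpace (X i)] {μ : ∀ i, Measure (X i)}
    [∀ i, IsProbabilityMeasure (μ i)] [IsDirectedOrder ι] [Nonempty ι]
    (hf : ∀ ⦃i j : ι⦄ (h : i ≤ j), Measurable (f h)) (hc : Convergent f μ) :
    Measure (Threads f) :=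
  (existsUnique_limit hf hc).choose

theorem limitMeasure_proj [∀ i, MeasurableSpace (X i)] {μ : ∀ i, Measure (X i)}
    [∀ i, IsProbabilityMeasure (μ i)] [IsDirectedOrder ι] [Nonempty ι]
    (hf : ∀ ⦃i j : ι⦄ (h : i ≤ j), Measurable (f h)) (hc : Convergent f μ)
    (i : ι) (A : Set (X i)) (hA : MeasurableSet A) :
    limitMeasure hf hc (Threads.proj i ⁻¹' A) = μ i A :=
  (existsUnique_limit hf hc).choose_spec.1 i A hA

theorem isProbabilityMeasure_limitMeasure [∀ i, MeasurableSpace (X i)] {μ : ∀ i, Measure (X i)}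
    [∀ i, IsProbabilityMeasure (μ i)] [IsDirectedOrder ι] [hι : Nonempty ι]
    (hf : ∀ ⦃i j : ι⦄ (h : i ≤ j), Measurable (f h)) (hc : Convergent f μ) :
    IsProbabilityMeasure (limitMeasure hf hc) := by
  refine ⟨?_⟩
  have := limitMeasure_proj hf hc hι.some univ MeasurableSet.univ
  simpa using this

end ProjSys

/-! ### Convolution systems -/

/-- A family of probability spaces `(Ω_{s,t}, F_{s,t}, μ_{s,t})`, `s < t`. -/
structure ProbFamily.{u, v} (S : Type u) [LinearOrder S] where
  /-- the underlying sets -/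
  Ω : ∀ ⦃s t : S⦄, s < t → Type v
  /-- the σ-fields -/
  mΩ : ∀ ⦃s t : S⦄ (h : s < t), MeasurableSpace (Ω h)
  /-- the measures -/
  μ : ∀ ⦃s t : S⦄ (h : s < t), Measure (Ω h)
  /-- the total masses are one -/
  prob : ∀ ⦃s t : S⦄ (h : s < t), IsProbabilityMeasure (μ h)

attribute [instance] ProbFamily.mΩ ProbFamily.prob

/-- Families of maps `T_{r,s,t} : Ω_{r,s} × Ω_{s,t} → Ω_{r,t}`, `r < s < t`. -/
abbrev ProbFamily.Mul {S : Type*} [LinearOrder S] (P : ProbFamily S) : Type _ :=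
  ∀ ⦃r s t : S⦄ (hrs : r < s) (hst : s < t), P.Ω hrs × P.Ω hst → P.Ω (hrs.trans hst)

/-- A convolution system over `S`. Relations between maps are understood up to null sets, so the
associativity of the multiplication is only required almost everywhere. -/
structure ConvolutionSystem.{u, v} (S : Type u) [LinearOrder S] extends ProbFamily.{u, v} S where
  /-- the multiplication `T_{r,s,t}` -/
  T : toProbFamily.Mul
  /-- the maps `T_{r,s,t}` are morphisms of probability spaces -/
  measurePreserving : ∀ ⦃r s t : S⦄ (hrs : r < s) (hst : s < t),
    MeasurePreserving (T hrs hst) ((μ hrs).prod (μ hst)) (μ (hrs.trans hst))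
  /-- associativity -/
  assoc : ∀ ⦃r s t u : S⦄ (hrs : r < s) (hst : s < t) (htu : t < u),
    ∀ᵐ x ∂((μ hrs).prod ((μ hst).prod (μ htu))),
      T (hrs.trans hst) htu (T hrs hst (x.1, x.2.1), x.2.2) =
        T hrs (hst.trans htu) (x.1, T hst htu (x.2.1, x.2.2))

/-- `g` is an isomorphism of probability spaces: a bijection, measurable in both directions, that
preserves the measure. -/
def IsProbIso {α β : Type*} [MeasurableSpace α] [MeasurableSpace β] (g : α → β)
    (μ : Measure α) (ν : Measure β) : Prop :=
  ∃ e : α ≃ᵐ β, (∀ x, e x = g x) ∧ MeasurePreserving e μ ν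

/-- A convolution system is a continuous product of probability spaces if the maps of its
multiplication are isomorphisms of probability spaces. -/
def ConvolutionSystem.IsCPPS {S : Type*} [LinearOrder S] (C : ConvolutionSystem S) : Prop :=
  ∀ ⦃r s t : S⦄ (hrs : r < s) (hst : s < t),
    IsProbIso (C.T hrs hst) ((C.μ hrs).prod (C.μ hst)) (C.μ (hrs.trans hst))

/-! ### Finite partitions -/

section Partitions

variable {S : Type*} [LinearOrder S]

/-- The pairs of consecutive elements of a finite subset of `S`. -/
def gaps (I : Finset S) : Finset (S × S) :=
  (I ×ˢ I).filter fun p => p.1 < p.2 ∧ ∀ x ∈ I, ¬ (p.1 < x ∧ x < p.2)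

lemma mem_gaps {I : Finset S} {p : S × S} :
    p ∈ gaps I ↔ (p.1 ∈ I ∧ p.2 ∈ I) ∧ p.1 < p.2 ∧ ∀ x ∈ I, ¬ (p.1 < x ∧ x < p.2) := by
  simp [gaps]

lemma lt_of_mem_gaps {I : Finset S} {p : S × S} (h : p ∈ gaps I) : p.1 < p.2 :=
  (mem_gaps.1 h).2.1

/-- The finite partitions of the interval `[s, t]`, given by their sets of division points and
ordered by inclusion. -/
abbrev Partn (s t : S) : Type _ :=
  {I : Finset S // s ∈ I ∧ t ∈ I ∧ ∀ x ∈ I, s ≤ x ∧ x ≤ t}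

/-- The trivial partition `{s, t}`. -/
def Partn.trivial {s t : S} (h : s < t) : Partn s t :=
  ⟨{s, t}, by simp, by simp, by simp [h.le]⟩

lemma Partn.isDirectedOrder (s t : S) : IsDirectedOrder (Partn s t) :=
  ⟨fun I J => ⟨⟨I.1 ∪ J.1, Finset.mem_union_left _ I.2.1, Finset.mem_union_left _ I.2.2.1,
      fun x hx => (Finset.mem_union.1 hx).elim (I.2.2.2 x) (J.2.2.2 x)⟩,
    Finset.subset_union_left (s₁ := I.1), Finset.subset_union_right (s₂ := J.1)⟩⟩

attribute [instance] Partn.isDirectedOrder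

/-- A partition of `[r, s]` and a partition of `[s, t]` together form a partition of `[r, t]`;
all partitions of `[r, t]` that have `s` as a division point are of this form. -/
def Partn.union {r s t : S} (hrs : r < s) (hst : s < t) (I : Partn r s) (J : Partn s t) :
    Partn r t :=
  ⟨I.1 ∪ J.1, Finset.mem_union_left _ I.2.1, Finset.mem_union_right _ J.2.2.1, fun x hx =>
    (Finset.mem_union.1 hx).elim (fun h => ⟨(I.2.2.2 x h).1, (I.2.2.2 x h).2.trans hst.le⟩)
      (fun h => ⟨hrs.le.trans (J.2.2.2 x h).1, (J.2.2.2 x h).2⟩)⟩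

lemma gaps_union {r s t : S} (hrs : r < s) (hst : s < t) (I : Partn r s) (J : Partn s t) :
    gaps (I.union hrs hst J).1 = gaps I.1 ∪ gaps J.1 := by
  obtain ⟨I, hrI, hsI, hI⟩ := I
  obtain ⟨J, hsJ, htJ, hJ⟩ := J
  ext ⟨a, b⟩
  simp only [Partn.union, Finset.mem_union, mem_gaps]
  constructor
  · rintro ⟨⟨ha, hb⟩, hab, hn⟩
    have hs : ¬ (a < s ∧ s < b) := hn s (Or.inl hsI)
    rcases le_or_gt b s with hbs | hbs
    · left
      refine ⟨⟨?_, ?_⟩, hab, fun x hx => hn x (Or.inl hx)⟩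
      · exact ha.elim id fun h => absurd ((hJ a h).1) (not_le.2 (hab.trans_le hbs))
      · refine hb.elim id fun h => ?_
        rw [le_antisymm hbs (hJ b h).1]
        exact hsI
    · right
      have has : s ≤ a := not_lt.1 fun h => hs ⟨h, hbs⟩
      refine ⟨⟨?_, ?_⟩, hab, fun x hx => hn x (Or.inr hx)⟩
      · refine ha.elim (fun h => ?_) id
        rw [le_antisymm (hI a h).2 has]
        exact hsJ
      · exact hb.elim (fun h => absurd ((hI b h).2) (not_le.2 hbs)) id
  · rintro (⟨⟨ha, hb⟩, hab, hn⟩ | ⟨⟨ha, hb⟩, hab, hn⟩)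
    · refine ⟨⟨Or.inl ha, Or.inl hb⟩, hab, fun x hx hx' => hx.elim (fun h => hn x h hx') fun h => ?_⟩
      exact absurd (hx'.2.trans_le (hI b hb).2) (not_lt.2 (hJ x h).1)
    · refine ⟨⟨Or.inr ha, Or.inr hb⟩, hab, fun x hx hx' => hx.elim (fun h => ?_) fun h => hn x h hx'⟩
      exact absurd ((hJ a ha).1.trans_lt hx'.1) (not_lt.2 (hI x h).2)

end Partitions

/-! ### The product spaces over partitions and the projective limits -/

/-- The product `Ω_I` of the spaces `Ω_{a,b}` over all pairs `a < b` of consecutive elements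
of `I`, with the product σ-field. -/
abbrev ProbFamily.Prod {S : Type*} [LinearOrder S] (P : ProbFamily S) (I : Finset S) : Type _ :=
  ∀ p : gaps I, P.Ω (lt_of_mem_gaps p.2)

/-- The product measure `μ_I` on `Ω_I`. -/
noncomputable def ProbFamily.prodMeasure {S : Type*} [LinearOrder S] (P : ProbFamily S)
    (I : Finset S) : Measure (P.Prod I) :=
  Measure.pi fun p : gaps I => P.μ (lt_of_mem_gaps p.2)

instance ProbFamily.isProbabilityMeasure_prodMeasure {S : Type*} [LinearOrder S]
    (P : ProbFamily S) (I : Finset S) : IsProbabilityMeasure (P.prodMeasure I) := by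
  unfold ProbFamily.prodMeasure
  infer_instance

/-- The identification `Ω_{I ∪ J} = Ω_I × Ω_J`, for partitions `I` of `[r, s]` and `J`
of `[s, t]`. -/
def ProbFamily.split {S : Type*} [LinearOrder S] (P : ProbFamily S) {r s t : S}
    (hrs : r < s) (hst : s < t) (I : Partn r s) (J : Partn s t)
    (ω : P.Prod (I.union hrs hst J).1) : P.Prod I.1 × P.Prod J.1 :=
  (fun p => ω ⟨p.1, by rw [gaps_union]; exact Finset.mem_union_left _ p.2⟩,
    fun p => ω ⟨p.1, by rw [gaps_union]; exact Finset.mem_union_right _ p.2⟩)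

namespace ConvolutionSystem

variable {S : Type*} [LinearOrder S] (C : ConvolutionSystem S)

/-- For `a < b` in `J`, with `a = j₀ < j₁ < ⋯ < jₙ₊₁ = b` the elements of `J` in `[a, b]`, the
product in `Ω_{a,b}` of the components of `ω` over `(j₀, j₁), …, (jₙ, jₙ₊₁)`. It is computed
iteratively: the product over `[a, jₙ]` is multiplied by the last component. -/
noncomputable def multiply {J : Finset S} (ω : C.Prod J) (a b : S) (ha : a ∈ J) (hb : b ∈ J)
    (hab : a < b) : C.Ω hab :=
  if h : (J.filter fun x => a < x ∧ x < b).Nonempty then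
    have hp := Finset.mem_filter.1 (Finset.max'_mem _ h)
    C.T hp.2.1 hp.2.2
      (multiply ω a ((J.filter fun x => a < x ∧ x < b).max' h) ha hp.1 hp.2.1,
        ω ⟨((J.filter fun x => a < x ∧ x < b).max' h, b), mem_gaps.2 ⟨⟨hp.1, hb⟩, hp.2.2,
          fun x hx hx' => absurd (Finset.le_max' _ x
            (Finset.mem_filter.2 ⟨hx, hp.2.1.trans hx'.1, hx'.2⟩)) (not_le.2 hx'.1)⟩⟩)
  else
    ω ⟨(a, b), mem_gaps.2 ⟨⟨ha, hb⟩, hab,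
      fun x hx hx' => h ⟨x, Finset.mem_filter.2 ⟨hx, hx'⟩⟩⟩⟩
termination_by (J.filter fun x => a < x ∧ x < b).card
decreasing_by
  refine Finset.card_lt_card (Finset.ssubset_iff_of_subset ?_ |>.2
    ⟨_, Finset.max'_mem _ h, by simp⟩)
  intro x hx
  rw [Finset.mem_filter] at hx ⊢
  exact ⟨hx.1, hx.2.1, hx.2.2.trans hp.2.2⟩

/-- The connecting map `T_{I,J} : Ω_J → Ω_I` for a refinement `J` of `I`. Its component at a pair
`a < b` of consecutive elements of `I` multiplies the components over the part of `J` in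
`[a, b]`. -/
noncomputable def connect {s t : S} ⦃I J : Partn s t⦄ (h : I ≤ J) (ω : C.Prod J.1) : C.Prod I.1 :=
  fun p => C.multiply ω p.1.1 p.1.2 (h (mem_gaps.1 p.2).1.1) (h (mem_gaps.1 p.2).1.2)
    (lt_of_mem_gaps p.2)

lemma measurable_multiply {J : Finset S} (a : S) (ha : a ∈ J) (n : ℕ) :
    ∀ (b : S) (hb : b ∈ J) (hab : a < b), (J.filter fun x => a < x ∧ x < b).card ≤ n →
      Measurable fun ω : C.Prod J => C.multiply ω a b ha hb hab := by
  induction n with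
  | zero =>
    intro b hb hab hn
    have h : ¬ (J.filter fun x => a < x ∧ x < b).Nonempty := by
      rw [Finset.not_nonempty_iff_eq_empty, ← Finset.card_eq_zero]
      omega
    have : (fun ω : C.Prod J => C.multiply ω a b ha hb hab) = fun ω => ω ⟨(a, b), mem_gaps.2
        ⟨⟨ha, hb⟩, hab, fun x hx hx' => h ⟨x, Finset.mem_filter.2 ⟨hx, hx'⟩⟩⟩⟩ := by
      funext ω
      rw [multiply, dif_neg h]
    rw [this]
    exact measurable_pi_apply _
  | succ n ih =>
    intro b hb hab hn
    by_cases h : (J.filter fun x => a < x ∧ x < b).Nonempty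
    · have hp := Finset.mem_filter.1 (Finset.max'_mem _ h)
      have hlt : (J.filter fun x => a < x ∧
          x < (J.filter fun x => a < x ∧ x < b).max' h).card ≤ n := by
        refine Nat.le_of_lt_succ (lt_of_lt_of_le (Finset.card_lt_card
          (Finset.ssubset_iff_of_subset ?_ |>.2 ⟨_, Finset.max'_mem _ h, by simp⟩)) hn)
        intro x hx
        rw [Finset.mem_filter] at hx ⊢
        exact ⟨hx.1, hx.2.1, hx.2.2.trans hp.2.2⟩
      have := ih _ hp.1 hp.2.1 hlt
      have e : (fun ω : C.Prod J => C.multiply ω a b ha hb hab) = fun ω => C.T hp.2.1 hp.2.2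
          (C.multiply ω a ((J.filter fun x => a < x ∧ x < b).max' h) ha hp.1 hp.2.1,
            ω ⟨((J.filter fun x => a < x ∧ x < b).max' h, b), mem_gaps.2 ⟨⟨hp.1, hb⟩, hp.2.2,
              fun x hx hx' => absurd (Finset.le_max' _ x
                (Finset.mem_filter.2 ⟨hx, hp.2.1.trans hx'.1, hx'.2⟩)) (not_le.2 hx'.1)⟩⟩) := by
        funext ω
        rw [multiply, dif_pos h]
      rw [e]
      exact (C.measurePreserving hp.2.1 hp.2.2).measurable.comp
        (this.prodMk (measurable_pi_apply _))
    · refine ih b hb hab ?_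
      rw [Finset.not_nonempty_iff_eq_empty] at h
      simp [h]

lemma measurable_connect {s t : S} ⦃I J : Partn s t⦄ (h : I ≤ J) : Measurable (C.connect h) :=
  measurable_pi_lambda _ fun _ => C.measurable_multiply _ _ _ _ _ _ le_rfl

/-- A convolution system is convergent if, for all `s < t`, the projective system of the spaces
`(Ω_I, F_I, μ_I)` over the finite partitions `I` of `[s, t]` is convergent. -/
def IsConvergent : Prop :=
  ∀ ⦃s t : S⦄, s < t →
    ProjSys.Convergent (C.connect (s := s) (t := t)) fun I => C.prodMeasure I.1

/-- The projective limits `(Ω♭_{s,t}, F♭_{s,t}, μ♭_{s,t})` of a convergent convolution system. -/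
noncomputable def flat (hC : C.IsConvergent) : ProbFamily S where
  Ω s t _ := ProjSys.Threads (C.connect (s := s) (t := t))
  mΩ _ _ _ := inferInstance
  μ _ _ h :=
    haveI : Nonempty (Partn _ _) := ⟨Partn.trivial h⟩
    ProjSys.limitMeasure C.measurable_connect (hC h)
  prob _ _ h :=
    haveI : Nonempty (Partn _ _) := ⟨Partn.trivial h⟩
    ProjSys.isProbabilityMeasure_limitMeasure C.measurable_connect (hC h)

/-- The canonical projection `T♭_I : Ω♭_{s,t} → Ω_I`. -/
noncomputable def flatProj (hC : C.IsConvergent) {s t : S} (h : s < t) (I : Partn s t)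
    (ω : (C.flat hC).Ω h) : C.Prod I.1 :=
  ProjSys.Threads.proj I ω

end ConvolutionSystem

/-! ### Splitting partitions at an intermediate point -/

/-! A partition of `[r, t]` having `s` as a division point is the same as a pair of partitions `I`
of `[r, s]` and `J` of `[s, t]`, and such partitions are cofinal. Over them the projective system is
a product of two systems: `Ω_{I ∪ J} = Ω_I × Ω_J` with the product measure
(`measurePreserving_splitEquiv`), and the connecting maps act on each factor separately
(`split_connect`). Hence a thread on `[r, t]` amounts to a pair of threads on `[r, s]` and `[s, t]`;
`concat` and `restrict` are the two directions.

The delicate point is that `T` is associative only almost everywhere, so the connecting maps need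
not compose correctly at every point. Convergence repairs this: each point of `Ω_K` is a coordinate
of a thread, and along a thread the connecting maps do compose (`IsConvergent.connect_connect`).
This makes the extension of a concatenation from the partitions through `s` to all partitions
consistent (`connect_glue_eq`).

Concatenation multiplies nothing at partitions through `s`; it only lists components side by side,
so it is associative everywhere (`concat_assoc`). It preserves measure because the image measure has
the right marginals and the limit measure is determined by them (`eq_flatMeasure`). -/

namespace Partn

variable {S : Type*} [LinearOrder S] {r s t : S}

/-- The part of a partition of `[r, t]` in `[r, s]`, with `s` added as a division point. -/
def left (hrs : r < s) (K : Partn r t) : Partn r s :=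
  ⟨insert s (K.1.filter (· ≤ s)), by simp [K.2.1, hrs.le], by simp, by
    intro x hx
    rcases Finset.mem_insert.1 hx with rfl | hx
    · exact ⟨hrs.le, le_rfl⟩
    · exact ⟨(K.2.2.2 x (Finset.mem_filter.1 hx).1).1, (Finset.mem_filter.1 hx).2⟩⟩

/-- The part of a partition of `[r, t]` in `[s, t]`, with `s` added as a division point. -/
def right (hst : s < t) (K : Partn r t) : Partn s t :=
  ⟨insert s (K.1.filter (s ≤ ·)), by simp, by simp [K.2.2.1, hst.le], by
    intro x hx
    rcases Finset.mem_insert.1 hx with rfl | hx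
    · exact ⟨le_rfl, hst.le⟩
    · exact ⟨(Finset.mem_filter.1 hx).2, (K.2.2.2 x (Finset.mem_filter.1 hx).1).2⟩⟩

/-- This is the cofinality of the partitions through `s`. The point `s` need not belong to `K`, so
the refinement may be strict. -/
lemma le_left_union_right (hrs : r < s) (hst : s < t) (K : Partn r t) :
    K ≤ (K.left hrs).union hrs hst (K.right hst) := by
  intro x hx
  rcases le_total x s with h | h
  · exact Finset.mem_union_left _ (Finset.mem_insert_of_mem (Finset.mem_filter.2 ⟨hx, h⟩))
  · exact Finset.mem_union_right _ (Finset.mem_insert_of_mem (Finset.mem_filter.2 ⟨hx, h⟩))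

/-- With `right_le`: `K.left` and `K.right` form the least pair whose union refines `K`. A point of
`J` that is at most `s` can only be `s`, which belongs to `I` as well. -/
lemma left_le {hrs : r < s} {hst : s < t} {K : Partn r t} {I : Partn r s} {J : Partn s t}
    (h : K ≤ I.union hrs hst J) : K.left hrs ≤ I := by
  intro x hx
  rcases Finset.mem_insert.1 hx with rfl | hx
  · exact I.2.2.1
  · obtain ⟨hx, hxs⟩ := Finset.mem_filter.1 hx
    rcases Finset.mem_union.1 (h hx) with h | h
    · exact h
    · rw [le_antisymm hxs (J.2.2.2 x h).1]
      exact I.2.2.1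

lemma right_le {hrs : r < s} {hst : s < t} {K : Partn r t} {I : Partn r s} {J : Partn s t}
    (h : K ≤ I.union hrs hst J) : K.right hst ≤ J := by
  intro x hx
  rcases Finset.mem_insert.1 hx with rfl | hx
  · exact J.2.1
  · obtain ⟨hx, hxs⟩ := Finset.mem_filter.1 hx
    rcases Finset.mem_union.1 (h hx) with h | h
    · rw [le_antisymm (I.2.2.2 x h).2 hxs]
      exact J.2.1
    · exact h

lemma union_mono (hrs : r < s) (hst : s < t) {I I' : Partn r s} {J J' : Partn s t}
    (hI : I ≤ I') (hJ : J ≤ J') : I.union hrs hst J ≤ I'.union hrs hst J' :=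
  Finset.union_subset_union hI hJ

lemma trivial_le (h : s < t) (I : Partn s t) : Partn.trivial h ≤ I := by
  intro x hx
  rcases Finset.mem_insert.1 hx with rfl | hx
  · exact I.2.1
  · rw [Finset.mem_singleton.1 hx]
    exact I.2.2.1

lemma union_assoc {u : S} (hrs : r < s) (hst : s < t) (htu : t < u) (I : Partn r s)
    (J : Partn s t) (K : Partn t u) :
    (I.union hrs hst J).union (hrs.trans hst) htu K =
      I.union hrs (hst.trans htu) (J.union hst htu K) :=
  Subtype.ext (Finset.union_assoc _ _ _)

variable (hrs : r < s) (hst : s < t) (I : Partn r s) (J : Partn s t)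

lemma mem_gaps_union_left {p : S × S} (hp : p ∈ gaps I.1) : p ∈ gaps (I.union hrs hst J).1 := by
  rw [gaps_union]
  exact Finset.mem_union_left _ hp

lemma mem_gaps_union_right {p : S × S} (hp : p ∈ gaps J.1) : p ∈ gaps (I.union hrs hst J).1 := by
  rw [gaps_union]
  exact Finset.mem_union_right _ hp

/-- A common pair `(a, b)` would satisfy `b ≤ s ≤ a`. -/
lemma disjoint_gaps : Disjoint (gaps I.1) (gaps J.1) := by
  rw [Finset.disjoint_left]
  intro p hI hJ
  exact absurd (lt_of_mem_gaps hI)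
    (not_lt.2 ((I.2.2.2 _ (mem_gaps.1 hI).1.2).2.trans (J.2.2.2 _ (mem_gaps.1 hJ).1.1).1))

/-- The pairs of consecutive elements of `I ∪ J` are those of `I` and those of `J`. -/
noncomputable def gapsEquiv : gaps I.1 ⊕ gaps J.1 ≃ gaps (I.union hrs hst J).1 :=
  Equiv.ofBijective
    (Sum.elim (fun p => ⟨p.1, mem_gaps_union_left hrs hst I J p.2⟩)
      fun p => ⟨p.1, mem_gaps_union_right hrs hst I J p.2⟩) (by
    have hd := Finset.disjoint_left.1 (disjoint_gaps I J)
    refine ⟨?_, ?_⟩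
    · rintro (⟨p, hp⟩ | ⟨p, hp⟩) (⟨q, hq⟩ | ⟨q, hq⟩) h
      all_goals
        have h := congrArg Subtype.val h
        simp only [Sum.elim_inl, Sum.elim_inr] at h
        subst h
      · rfl
      · exact absurd hq (hd hp)
      · exact absurd hp (hd hq)
      · rfl
    · rintro ⟨p, hp⟩
      rw [gaps_union] at hp
      rcases Finset.mem_union.1 hp with h | h
      · exact ⟨Sum.inl ⟨p, h⟩, rfl⟩
      · exact ⟨Sum.inr ⟨p, h⟩, rfl⟩)

end Partn

/-! ### Product spaces over partitions through an intermediate point -/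

namespace ProbFamily

variable {S : Type*} [LinearOrder S] (P : ProbFamily S) {r s t : S} (hrs : r < s) (hst : s < t)
  (I : Partn r s) (J : Partn s t)

/-- The identification `Ω_{I ∪ J} = Ω_I × Ω_J` as an equivalence of measurable spaces. -/
noncomputable def splitEquiv : P.Prod (I.union hrs hst J).1 ≃ᵐ P.Prod I.1 × P.Prod J.1 :=
  (MeasurableEquiv.piCongrLeft (fun p : gaps (I.union hrs hst J).1 => P.Ω (lt_of_mem_gaps p.2))
    (Partn.gapsEquiv hrs hst I J)).symm.trans
  (MeasurableEquiv.sumPiEquivProdPi fun p : gaps I.1 ⊕ gaps J.1 =>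
    P.Ω (lt_of_mem_gaps (Partn.gapsEquiv hrs hst I J p).2))

/-- Definitional, since the inverse of `piCongrLeft` is plain reindexing along `gapsEquiv`, which
keeps the underlying pairs. -/
lemma splitEquiv_apply (ω : P.Prod (I.union hrs hst J).1) :
    P.splitEquiv hrs hst I J ω = P.split hrs hst I J ω := rfl

lemma measurePreserving_splitEquiv :
    MeasurePreserving (P.splitEquiv hrs hst I J) (P.prodMeasure (I.union hrs hst J).1)
      ((P.prodMeasure I.1).prod (P.prodMeasure J.1)) :=
  (measurePreserving_sumPiEquivProdPi fun p : gaps I.1 ⊕ gaps J.1 =>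
      P.μ (lt_of_mem_gaps (Partn.gapsEquiv hrs hst I J p).2)).comp
    ((measurePreserving_piCongrLeft
      (fun p : gaps (I.union hrs hst J).1 => P.μ (lt_of_mem_gaps p.2))
      (Partn.gapsEquiv hrs hst I J)).symm _)

end ProbFamily

namespace ConvolutionSystem

open ProjSys

variable {S : Type*} [LinearOrder S] (C : ConvolutionSystem S)

/-! ### The connecting maps -/

lemma multiply_of_mem_gaps {J : Finset S} (ω : C.Prod J) {a b : S} (ha : a ∈ J) (hb : b ∈ J)
    (hab : a < b) (h : (a, b) ∈ gaps J) : C.multiply ω a b ha hb hab = ω ⟨(a, b), h⟩ := by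
  rw [multiply, dif_neg]
  rintro ⟨x, hx⟩
  obtain ⟨hx, hx'⟩ := Finset.mem_filter.1 hx
  exact (mem_gaps.1 h).2.2 x hx hx'

/-- The recursion for `multiply`, freed from `max'`: the last intermediate point may be any `c`
known to precede `b` immediately. -/
lemma multiply_of_lt {J : Finset S} (ω : C.Prod J) {a b c : S} (ha : a ∈ J) (hb : b ∈ J)
    (hab : a < b) (hac : a < c) (h : (c, b) ∈ gaps J) :
    C.multiply ω a b ha hb hab = C.T hac (lt_of_mem_gaps h)
      (C.multiply ω a c ha (mem_gaps.1 h).1.1 hac, ω ⟨(c, b), h⟩) := by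
  obtain ⟨⟨hc, _⟩, hcb, hn⟩ := mem_gaps.1 h
  have hmem : c ∈ J.filter fun x => a < x ∧ x < b := Finset.mem_filter.2 ⟨hc, hac, hcb⟩
  have hmax : (J.filter fun x => a < x ∧ x < b).max' ⟨c, hmem⟩ = c := by
    refine le_antisymm (Finset.max'_le _ _ _ fun x hx => ?_) (Finset.le_max' _ _ hmem)
    obtain ⟨hx, _, hxb⟩ := Finset.mem_filter.1 hx
    exact not_lt.1 fun hcx => hn x hx ⟨hcx, hxb⟩
  -- The types depend on the intermediate point, so `max' = c` cannot be rewritten directly; with a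
  -- variable `d` in place of the maximum, the equality can be substituted.
  have key : ∀ (d : S) (hd : (d, b) ∈ gaps J) (had : a < d), d = c →
      C.T had (lt_of_mem_gaps hd) (C.multiply ω a d ha (mem_gaps.1 hd).1.1 had, ω ⟨(d, b), hd⟩) =
        C.T hac (lt_of_mem_gaps h) (C.multiply ω a c ha hc hac, ω ⟨(c, b), h⟩) := by
    rintro d hd had rfl
    rfl
  rw [multiply, dif_pos ⟨c, hmem⟩]
  exact key _ (by rwa [hmax]) (by rwa [hmax]) hmax

/-- Iterated products over `[a, b]` depend only on the division points and components
in `[a, b]`. -/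
lemma multiply_congr {J J' : Finset S} (ω : C.Prod J) (ω' : C.Prod J') {a : S} (ha : a ∈ J)
    (ha' : a ∈ J') (n : ℕ) : ∀ (b : S) (hb : b ∈ J) (hb' : b ∈ J') (hab : a < b),
      (J.filter fun x => a < x ∧ x < b).card ≤ n →
      (∀ x, a ≤ x → x ≤ b → (x ∈ J ↔ x ∈ J')) →
      (∀ p (hp : p ∈ gaps J) (hp' : p ∈ gaps J'), a ≤ p.1 → p.2 ≤ b →
        ω ⟨p, hp⟩ = ω' ⟨p, hp'⟩) →
      C.multiply ω a b ha hb hab = C.multiply ω' a b ha' hb' hab := by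
  -- Points consecutive in `J` stay consecutive in `J'`, because the two sets agree on `[a, b]`.
  have gap : ∀ {b c : S}, (∀ x, a ≤ x → x ≤ b → (x ∈ J ↔ x ∈ J')) → a ≤ c → b ∈ J' →
      (c, b) ∈ gaps J → (c, b) ∈ gaps J' := by
    intro b c hJ hac hb' h
    obtain ⟨⟨hc, _⟩, hcb, hn⟩ := mem_gaps.1 h
    exact mem_gaps.2 ⟨⟨(hJ c hac hcb.le).1 hc, hb'⟩, hcb, fun x hx hx' =>
      hn x ((hJ x (hac.trans hx'.1.le) hx'.2.le).2 hx) hx'⟩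
  induction n with
  | zero =>
    intro b hb hb' hab hn hJ hω
    have h : (a, b) ∈ gaps J := mem_gaps.2 ⟨⟨ha, hb⟩, hab, fun x hx hx' => by
      have := Finset.card_eq_zero.1 (Nat.le_zero.1 hn)
      exact Finset.notMem_empty x (this ▸ Finset.mem_filter.2 ⟨hx, hx'⟩)⟩
    rw [C.multiply_of_mem_gaps ω ha hb hab h,
      C.multiply_of_mem_gaps ω' ha' hb' hab (gap hJ le_rfl hb' h)]
    exact hω _ _ _ le_rfl le_rfl
  | succ n ih =>
    intro b hb hb' hab hn hJ hω
    by_cases h : (J.filter fun x => a < x ∧ x < b).Nonempty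
    · obtain ⟨c, hc, hmax⟩ := Finset.exists_max_image _ id h
      obtain ⟨hc, hac, hcb⟩ := Finset.mem_filter.1 hc
      have hg : (c, b) ∈ gaps J := mem_gaps.2 ⟨⟨hc, hb⟩, hcb, fun x hx hx' =>
        absurd (hmax x (Finset.mem_filter.2 ⟨hx, hac.trans hx'.1, hx'.2⟩)) (not_le.2 hx'.1)⟩
      have hg' := gap hJ hac.le hb' hg
      have hlt : (J.filter fun x => a < x ∧ x < c).card ≤ n := by
        refine Nat.le_of_lt_succ (lt_of_lt_of_le (Finset.card_lt_card
          (Finset.ssubset_iff_of_subset ?_ |>.2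
            ⟨c, Finset.mem_filter.2 ⟨hc, hac, hcb⟩, by simp⟩)) hn)
        intro x hx
        rw [Finset.mem_filter] at hx ⊢
        exact ⟨hx.1, hx.2.1, hx.2.2.trans hcb⟩
      rw [C.multiply_of_lt ω ha hb hab hac hg, C.multiply_of_lt ω' ha' hb' hab hac hg',
        ih c hc (mem_gaps.1 hg').1.1 hac hlt (fun x hx hx' => hJ x hx (hx'.trans hcb.le))
          (fun p hp hp' h1 h2 => hω p hp hp' h1 (h2.trans hcb.le)),
        hω _ hg hg' hac.le le_rfl]
    · refine ih b hb hb' hab ?_ hJ hω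
      rw [Finset.not_nonempty_iff_eq_empty] at h
      simp [h]

lemma connect_rfl {s t : S} (I : Partn s t) (ω : C.Prod I.1) :
    C.connect (le_refl I) ω = ω :=
  funext fun p => C.multiply_of_mem_gaps ω _ _ _ p.2

/-- Consecutive points of `I` lie in `[r, s]`, where `I' ∪ J'` has the same points as `I'`; so
`multiply_congr` makes the components over `J'` irrelevant there. The other factor is symmetric. -/
lemma split_connect {r s t : S} (hrs : r < s) (hst : s < t) {I I' : Partn r s} {J J' : Partn s t}
    (hI : I ≤ I') (hJ : J ≤ J') (h : I.union hrs hst J ≤ I'.union hrs hst J')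
    (ω : C.Prod (I'.union hrs hst J').1) :
    C.split hrs hst I J (C.connect h ω) =
      (C.connect hI (C.split hrs hst I' J' ω).1, C.connect hJ (C.split hrs hst I' J' ω).2) := by
  refine Prod.ext (funext fun p => ?_) (funext fun p => ?_)
  · obtain ⟨⟨hp1, hp2⟩, -, -⟩ := mem_gaps.1 p.2
    refine C.multiply_congr _ _ _ _ _ _ _ _ _ le_rfl (fun x _ hx' => ?_) fun q _ _ _ _ => rfl
    refine ⟨fun hx => (Finset.mem_union.1 hx).elim id fun hx => ?_, Finset.mem_union_left _⟩
    -- A point of `J'` not beyond the end of a gap of `I` is both `≥ s` and `≤ s`.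
    rw [le_antisymm (hx'.trans (I.2.2.2 _ hp2).2) (J'.2.2.2 x hx).1]
    exact I'.2.2.1
  · obtain ⟨⟨hp1, hp2⟩, -, -⟩ := mem_gaps.1 p.2
    refine C.multiply_congr _ _ _ _ _ _ _ _ _ le_rfl (fun x hx' _ => ?_) fun q _ _ _ _ => rfl
    refine ⟨fun hx => (Finset.mem_union.1 hx).elim (fun hx => ?_) id, Finset.mem_union_right _⟩
    rw [le_antisymm (I'.2.2.2 x hx).2 ((J.2.2.2 _ hp1).1.trans hx')]
    exact J'.2.1

lemma splitEquiv_connect {r s t : S} (hrs : r < s) (hst : s < t) {I I' : Partn r s}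
    {J J' : Partn s t} (hI : I ≤ I') (hJ : J ≤ J') (x : C.Prod I'.1 × C.Prod J'.1) :
    C.connect (Partn.union_mono hrs hst hI hJ) ((C.splitEquiv hrs hst I' J').symm x) =
      (C.splitEquiv hrs hst I J).symm (C.connect hI x.1, C.connect hJ x.2) := by
  rw [MeasurableEquiv.eq_symm_apply, ProbFamily.splitEquiv_apply, C.split_connect hrs hst hI hJ,
    ← ProbFamily.splitEquiv_apply, MeasurableEquiv.apply_symm_apply]

variable {C}

/-- In a convergent system the connecting maps are functorial everywhere, and not only almost
everywhere, because every point of `Ω_K` is the coordinate of a thread. -/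
lemma IsConvergent.connect_connect (hC : C.IsConvergent) {s t : S} (hst : s < t)
    {I J K : Partn s t} (hIJ : I ≤ J) (hJK : J ≤ K) (ω : C.Prod K.1) :
    C.connect hIJ (C.connect hJK ω) = C.connect (hIJ.trans hJK) ω := by
  obtain ⟨θ, rfl⟩ := (hC hst).1.2 K ω
  rw [← Threads.proj_eq hJK θ, ← Threads.proj_eq hIJ θ, ← Threads.proj_eq (hIJ.trans hJK) θ]

variable (C) in
/-- The threads on `[s, t]`. -/
abbrev FlatSpace (s t : S) : Type _ := Threads (C.connect (s := s) (t := t))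

/-! ### Concatenation of threads -/

section Concat

variable (hC : C.IsConvergent) {r s t : S} (hrs : r < s) (hst : s < t)

/-- The coordinate at `K` of a glued pair does not depend on the partitions used to compute it:
coordinates at `I`, `J` come from those at `I'`, `J'`, the connecting maps are products, and
functoriality everywhere collapses the composite. -/
lemma connect_glue_eq (hC : C.IsConvergent) {K : Partn r t} {I I' : Partn r s}
    {J J' : Partn s t} (hI : I ≤ I') (hJ : J ≤ J') (hK : K ≤ I.union hrs hst J)
    (hK' : K ≤ I'.union hrs hst J') (x : C.FlatSpace r s) (y : C.FlatSpace s t) :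
    C.connect hK ((C.splitEquiv hrs hst I J).symm (x.proj I, y.proj J)) =
      C.connect hK' ((C.splitEquiv hrs hst I' J').symm (x.proj I', y.proj J')) := by
  rw [Threads.proj_eq hI x, Threads.proj_eq hJ y,
    ← C.splitEquiv_connect hrs hst hI hJ (x.proj I', y.proj J'),
    hC.connect_connect (hrs.trans hst)]

/-- The concatenation of a thread on `[r, s]` and a thread on `[s, t]`. -/
noncomputable def concat (x : C.FlatSpace r s × C.FlatSpace s t) : C.FlatSpace r t :=
  ⟨fun K => C.connect (K.le_left_union_right hrs hst)
      ((C.splitEquiv hrs hst _ _).symm (x.1.proj _, x.2.proj _)), fun K L h => by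
    -- The pair attached to `L` also refines `K`, hence dominates the pair attached to `K` by
    -- minimality.
    have hK := h.trans (L.le_left_union_right hrs hst)
    rw [hC.connect_connect (hrs.trans hst)]
    exact connect_glue_eq hrs hst hC (Partn.left_le hK) (Partn.right_le hK) _ hK _ _⟩

lemma concat_proj (x : C.FlatSpace r s × C.FlatSpace s t) (I : Partn r s) (J : Partn s t) :
    (concat hC hrs hst x).proj (I.union hrs hst J) =
      (C.splitEquiv hrs hst I J).symm (x.1.proj I, x.2.proj J) := by
  have h := le_refl (I.union hrs hst J)
  -- For `K = I ∪ J` the glued value may be computed from `I` and `J` themselves, and the connecting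
  -- map is then the identity.
  exact (connect_glue_eq hrs hst hC (Partn.left_le h) (Partn.right_le h)
    (Partn.le_left_union_right hrs hst _) h _ _).trans
    (C.connect_rfl _ _)

lemma split_concat_proj (x : C.FlatSpace r s × C.FlatSpace s t) (I : Partn r s)
    (J : Partn s t) :
    C.split hrs hst I J ((concat hC hrs hst x).proj (I.union hrs hst J)) =
      (x.1.proj I, x.2.proj J) := by
  rw [concat_proj, ← ProbFamily.splitEquiv_apply, MeasurableEquiv.apply_symm_apply]

lemma threads_ext_union {z w : C.FlatSpace r t}
    (h : ∀ (I : Partn r s) (J : Partn s t),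
      z.proj (I.union hrs hst J) = w.proj (I.union hrs hst J)) : z = w := by
  refine Subtype.ext (funext fun K => ?_)
  have hK := K.le_left_union_right hrs hst
  change z.proj K = w.proj K
  rw [Threads.proj_eq hK z, Threads.proj_eq hK w, h]

/-- The restrictions of a thread on `[r, t]` to `[r, s]` and `[s, t]`. -/
noncomputable def restrict (z : C.FlatSpace r t) : C.FlatSpace r s × C.FlatSpace s t :=
  (⟨fun I => (C.split hrs hst I (Partn.trivial hst) (z.proj _)).1, fun I I' h => by
      beta_reduce
      rw [Threads.proj_eq (Partn.union_mono hrs hst h le_rfl) z,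
        C.split_connect hrs hst h le_rfl]⟩,
    ⟨fun J => (C.split hrs hst (Partn.trivial hrs) J (z.proj _)).2, fun J J' h => by
      beta_reduce
      rw [Threads.proj_eq (Partn.union_mono hrs hst le_rfl h) z,
        C.split_connect hrs hst le_rfl h]⟩)

/-- The trivial partition on the opposite side in `restrict` is an immaterial choice: refining that
side acts as the identity on the factor that is kept. -/
lemma restrict_proj (z : C.FlatSpace r t) (I : Partn r s) (J : Partn s t) :
    ((restrict hrs hst z).1.proj I, (restrict hrs hst z).2.proj J) =
      C.splitEquiv hrs hst I J (z.proj _) := by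
  refine Prod.ext ?_ ?_
  · change (C.split hrs hst I (Partn.trivial hst) (z.proj _)).1 = _
    rw [Threads.proj_eq (Partn.union_mono hrs hst le_rfl (J.trivial_le hst)) z,
      C.split_connect hrs hst le_rfl (J.trivial_le hst), C.connect_rfl]
    rfl
  · change (C.split hrs hst (Partn.trivial hrs) J (z.proj _)).2 = _
    rw [Threads.proj_eq (Partn.union_mono hrs hst (I.trivial_le hrs) le_rfl) z,
      C.split_connect hrs hst (I.trivial_le hrs) le_rfl, C.connect_rfl]
    rfl

lemma restrict_concat (x : C.FlatSpace r s × C.FlatSpace s t) :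
    restrict hrs hst (concat hC hrs hst x) = x := by
  refine Prod.ext (Subtype.ext (funext fun I => ?_)) (Subtype.ext (funext fun J => ?_))
  · exact congrArg Prod.fst (split_concat_proj hC hrs hst x I (Partn.trivial hst))
  · exact congrArg Prod.snd (split_concat_proj hC hrs hst x (Partn.trivial hrs) J)

lemma concat_restrict (z : C.FlatSpace r t) :
    concat hC hrs hst (restrict hrs hst z) = z :=
  threads_ext_union hrs hst fun I J => by
    rw [concat_proj, restrict_proj, MeasurableEquiv.symm_apply_apply]

lemma measurable_of_proj {α : Type*} [MeasurableSpace α] {f : α → C.FlatSpace s t}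
    (hf : ∀ I, Measurable fun a => (f a).proj I) : Measurable f := by
  rw [measurable_iff_comap_le, Threads.instMeasurableSpace, MeasurableSpace.comap_iSup]
  refine iSup_le fun I => ?_
  rw [MeasurableSpace.comap_comp]
  exact (hf I).comap_le

lemma measurable_concat : Measurable (concat hC hrs hst) :=
  measurable_of_proj fun K => (C.measurable_connect (K.le_left_union_right hrs hst)).comp
    ((C.splitEquiv hrs hst _ _).symm.measurable.comp
      (((Threads.measurable_proj _).comp measurable_fst).prodMk
        ((Threads.measurable_proj _).comp measurable_snd)))

lemma measurable_restrict : Measurable (restrict (C := C) hrs hst) := by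
  refine Measurable.prodMk (measurable_of_proj fun I => ?_) (measurable_of_proj fun J => ?_)
  · exact measurable_fst.comp ((C.splitEquiv hrs hst I (Partn.trivial hst)).measurable.comp
      (Threads.measurable_proj _))
  · exact measurable_snd.comp ((C.splitEquiv hrs hst (Partn.trivial hrs) J).measurable.comp
      (Threads.measurable_proj _))

/-- Concatenation of threads as an equivalence of measurable spaces. -/
noncomputable def concatEquiv : C.FlatSpace r s × C.FlatSpace s t ≃ᵐ C.FlatSpace r t where
  toFun := concat hC hrs hst
  invFun := restrict hrs hst
  left_inv := restrict_concat hC hrs hst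
  right_inv := concat_restrict hC hrs hst
  measurable_toFun := measurable_concat hC hrs hst
  measurable_invFun := measurable_restrict hrs hst

/-- The equation `hK` is a hypothesis because `concat_assoc` needs the other bracketing of `I ∪ J ∪
K`, on which the type of the coordinate depends. -/
lemma concat_proj_left (x : C.FlatSpace r s × C.FlatSpace s t) {I : Partn r s} {J : Partn s t}
    {K : Partn r t} (hK : I.union hrs hst J = K) {p : S × S} (hp : p ∈ gaps I.1)
    (hp' : p ∈ gaps K.1) :
    (concat hC hrs hst x).proj K ⟨p, hp'⟩ = x.1.proj I ⟨p, hp⟩ := by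
  subst hK
  exact congrFun (congrArg Prod.fst (split_concat_proj hC hrs hst x I J)) ⟨p, hp⟩

lemma concat_proj_right (x : C.FlatSpace r s × C.FlatSpace s t) {I : Partn r s} {J : Partn s t}
    {K : Partn r t} (hK : I.union hrs hst J = K) {p : S × S} (hp : p ∈ gaps J.1)
    (hp' : p ∈ gaps K.1) :
    (concat hC hrs hst x).proj K ⟨p, hp'⟩ = x.2.proj J ⟨p, hp⟩ := by
  subst hK
  exact congrFun (congrArg Prod.snd (split_concat_proj hC hrs hst x I J)) ⟨p, hp⟩

/-- Over a gap of `I ∪ J ∪ K` both sides have the component of whichever of `x`, `y`, `z` lives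
there, so the almost everywhere associativity of `T` plays no role. -/
lemma concat_assoc {u : S} (htu : t < u) (x : C.FlatSpace r s) (y : C.FlatSpace s t)
    (z : C.FlatSpace t u) :
    concat hC (hrs.trans hst) htu (concat hC hrs hst (x, y), z) =
      concat hC hrs (hst.trans htu) (x, concat hC hst htu (y, z)) := by
  have key : ∀ (I : Partn r s) (J : Partn s t) (K : Partn t u),
      (concat hC (hrs.trans hst) htu (concat hC hrs hst (x, y), z)).proj
          (I.union hrs (hst.trans htu) (J.union hst htu K)) =
        (concat hC hrs (hst.trans htu) (x, concat hC hst htu (y, z))).proj _ := by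
    intro I J K
    have hIJK := Partn.union_assoc hrs hst htu I J K
    funext ⟨p, hp⟩
    have hp' := hp
    rw [gaps_union, gaps_union] at hp'
    rcases Finset.mem_union.1 hp' with h | h
    · have h' := Partn.mem_gaps_union_left hrs hst I J h
      rw [concat_proj_left hC _ _ _ hIJK h', concat_proj_left hC _ _ _ rfl h,
        concat_proj_left hC _ _ _ rfl h]
    rcases Finset.mem_union.1 h with h | h
    · have h' := Partn.mem_gaps_union_right hrs hst I J h
      have h'' := Partn.mem_gaps_union_left hst htu J K h
      rw [concat_proj_left hC _ _ _ hIJK h', concat_proj_right hC _ _ _ rfl h,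
        concat_proj_right hC _ _ _ rfl h'', concat_proj_left hC _ _ _ rfl h]
    · have h'' := Partn.mem_gaps_union_right hst htu J K h
      rw [concat_proj_right hC _ _ _ hIJK h, concat_proj_right hC _ _ _ rfl h'',
        concat_proj_right hC _ _ _ rfl h]
  refine threads_ext_union hrs (hst.trans htu) fun I L => ?_
  -- A partition through `s` need not contain `t`; adding `t` gives one of the form treated in
  -- `key`.
  have h := Partn.union_mono hrs (hst.trans htu) (le_refl I) (L.le_left_union_right hst htu)
  exact (Threads.proj_eq h _).trans ((congrArg _ (key _ _ _)).trans (Threads.proj_eq h _).symm)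

/-! ### The measures -/

/-- The measure `μ♭_{s,t}` on the threads on `[s, t]`. -/
noncomputable def flatMeasure : Measure (C.FlatSpace s t) := (C.flat hC).μ hst

instance : IsProbabilityMeasure (flatMeasure hC hst) := (C.flat hC).prob hst

lemma flatMeasure_proj (I : Partn s t) {A : Set (C.Prod I.1)} (hA : MeasurableSet A) :
    flatMeasure hC hst (Threads.proj I ⁻¹' A) = C.prodMeasure I.1 A :=
  haveI : Nonempty (Partn s t) := ⟨Partn.trivial hst⟩
  limitMeasure_proj C.measurable_connect (hC hst) I A hA

lemma measurePreserving_proj (I : Partn s t) :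
    MeasurePreserving (Threads.proj I) (flatMeasure hC hst) (C.prodMeasure I.1) := by
  refine ⟨Threads.measurable_proj I, Measure.ext fun A hA => ?_⟩
  rw [Measure.map_apply (Threads.measurable_proj I) hA, flatMeasure_proj hC hst I hA]

/-- The projections to `Ω_I` and `Ω_J` preserve measure and differ by the connecting map, so no
induction over iterated products is needed. -/
lemma measurePreserving_connect (hC : C.IsConvergent) (hst : s < t) {I J : Partn s t} (h : I ≤ J) :
    MeasurePreserving (C.connect h) (C.prodMeasure J.1) (C.prodMeasure I.1) := by
  refine ⟨C.measurable_connect h, ?_⟩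
  rw [← (measurePreserving_proj hC hst J).map_eq, ← (measurePreserving_proj hC hst I).map_eq,
    Measure.map_map (C.measurable_connect h) (Threads.measurable_proj J)]
  exact congrArg (Measure.map · _) (funext fun θ => (Threads.proj_eq h θ).symm)

lemma eq_flatMeasure {ν : Measure (C.FlatSpace s t)}
    (h : ∀ I, ν.map (Threads.proj I) = C.prodMeasure I.1) : ν = flatMeasure hC hst := by
  have : Nonempty (Partn s t) := ⟨Partn.trivial hst⟩
  refine (existsUnique_limit C.measurable_connect (hC hst)).unique (fun I A hA => ?_)
    (fun I A hA => flatMeasure_proj hC hst I hA)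
  rw [← h I, Measure.map_apply (Threads.measurable_proj I) hA]

/-- By construction the coordinate at `K` of a concatenation is a composite of three
measure-preserving maps: a product of projections, the identification with `Ω_{I ∪ J}`, and a
connecting map. Uniqueness of the limit measure does the rest. -/
lemma measurePreserving_concat :
    MeasurePreserving (concat hC hrs hst) ((flatMeasure hC hrs).prod (flatMeasure hC hst))
      (flatMeasure hC (hrs.trans hst)) := by
  refine ⟨measurable_concat hC hrs hst, eq_flatMeasure hC (hrs.trans hst) fun K => ?_⟩
  rw [Measure.map_map (Threads.measurable_proj K) (measurable_concat hC hrs hst)]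
  exact ((measurePreserving_connect hC (hrs.trans hst) (K.le_left_union_right hrs hst)).comp
    (((C.measurePreserving_splitEquiv hrs hst _ _).symm _).comp
      ((measurePreserving_proj hC hrs _).prod (measurePreserving_proj hC hst _)))).map_eq

end Concat

end ConvolutionSystem

theorem theorem3p2 {S : Type*} [LinearOrder S] (C : ConvolutionSystem S) (hC : C.IsConvergent) :
    ∃ (Tflat : (C.flat hC).Mul)
      (hmp : ∀ ⦃r s t : S⦄ (hrs : r < s) (hst : s < t),
        MeasurePreserving (Tflat hrs hst) (((C.flat hC).μ hrs).prod ((C.flat hC).μ hst))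
          ((C.flat hC).μ (hrs.trans hst)))
      (hassoc : ∀ ⦃r s t u : S⦄ (hrs : r < s) (hst : s < t) (htu : t < u)
        (x : (C.flat hC).Ω hrs) (y : (C.flat hC).Ω hst) (z : (C.flat hC).Ω htu),
        Tflat (hrs.trans hst) htu (Tflat hrs hst (x, y), z) =
          Tflat hrs (hst.trans htu) (x, Tflat hst htu (y, z))),
      ConvolutionSystem.IsCPPS
        (ConvolutionSystem.mk (C.flat hC) Tflat hmp fun _ _ _ _ hrs hst htu =>
          ae_of_all _ fun x => hassoc hrs hst htu x.1 x.2.1 x.2.2) ∧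
      ∀ ⦃r s t : S⦄ (hrs : r < s) (hst : s < t) (I : Partn r s) (J : Partn s t)
        (x : (C.flat hC).Ω hrs) (y : (C.flat hC).Ω hst),
        C.split hrs hst I J
            (C.flatProj hC (hrs.trans hst) (I.union hrs hst J) (Tflat hrs hst (x, y))) =
          (C.flatProj hC hrs I x, C.flatProj hC hst J y) :=
  ⟨fun _ _ _ hrs hst => ConvolutionSystem.concat hC hrs hst,
    fun _ _ _ hrs hst => ConvolutionSystem.measurePreserving_concat hC hrs hst,
    fun _ _ _ _ hrs hst htu => ConvolutionSystem.concat_assoc hC hrs hst htu,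
    fun _ _ _ hrs hst => ⟨ConvolutionSystem.concatEquiv hC hrs hst, fun _ => rfl,
      ConvolutionSystem.measurePreserving_concat hC hrs hst⟩,
    fun _ _ _ hrs hst I J x y => ConvolutionSystem.split_concat_proj hC hrs hst (x, y) I J⟩
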